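/- All groups are discrete and countable. A mean on a set $X$ is a positive linear functional $m$ on the real Banach space $\ell^\infty(X)$ with $m(1)=1$. A group is amenable if it carries a mean invariant under left translations, and inner amenable if it carries a mean $m$ that is invariant under conjugation and satisfies $m(1_{\{e\}})=0$. An orthogonal representation $\pi:\Gamma\to\mathcal O(\mathcal H)$ on a real Hilbert space is mixing if $\langle\pi_\gamma(\xi),\eta\rangle\to 0$ as $\gamma\to\infty$ for all $\xi,\eta\in\mathcal H$, and weakly-$\ell^2$ if it is weakly contained in the left regular representation on $\ell^2_{\mathbb R}(\Gamma)$, i.e. every function $\gamma\mapsto\langle\pi_\gamma(\xi),\xi\rangle$ can be approximated, uniformly on finite subsets of $\Gamma$, by finite sums of functions $\gamma\mapsto\langle\lambda_\gamma(\eta),\eta\rangle$ with $\eta\in\ell^2_{\mathbb R}(\Gamma)$, where $\lambda$ is the left regular representation. A quasi-cocycle for $\pi$ is a map $q:\Gamma\to\mathcal H$ with $\sup_{\gamma,\lambda\in\Gamma}\|q(\gamma\lambda)-q(\gamma)-\pi_\gamma(q(\lambda))\|<\infty$; it is anti-symmetric if $q(\gamma)=-\pi_\gamma(q(\gamma^{-1}))$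 for all $\gamma\in\Gamma$. The class $NC_1$ consists of the non-amenable groups $\Gamma$ that admit an unbounded anti-symmetric quasi-cocycle for some mixing, weakly-$\ell^2$, orthogonal representation. A group is icc if it is infinite and the conjugacy class of every non-trivial element is infinite. Theorem. Let $\Gamma\in NC_1$ be a countable group. (1) For every non-amenable normal subgroup $\Sigma\lhd\Gamma$, the action of $\Sigma$ on $\Gamma$ by conjugation has only finitely many finite orbits. (2) $\Gamma$ has only finitely many finite conjugacy classes. (3) There is a short exact sequence of groups $1\to F\to\Gamma\to\Gamma_0\to 1$ with $F$ finite and $\Gamma_0$ icc. (4) If $\Gamma$ is torsion free, then $\Gamma$ is icc and not inner amenable. -/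

import Mathlib

open Filter Topology
open scoped ENNReal

universe u v w

namespace GroupNC

/-! ### Means, amenability, inner amenability -/

/-- A mean on the set `X`: a positive normalized linear functional on `ℓ^∞(X)`. -/
def IsMean {X : Type u} (m : lp (fun _ : X => ℝ) ∞ →ₗ[ℝ] ℝ) : Prop :=
  (∀ f : lp (fun _ : X => ℝ) ∞, (∀ x, 0 ≤ f x) → 0 ≤ m f) ∧ m 1 = 1

/-- The mean `m` takes the same value on `f` and on `f ∘ φ`, for all bounded `f`. -/
def InvariantUnder {X : Type u} (m : lp (fun _ : X => ℝ) ∞ →ₗ[ℝ] ℝ) (φ : X → X) : Prop :=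
  ∀ f f' : lp (fun _ : X => ℝ) ∞, (∀ x, f' x = f (φ x)) → m f' = m f

/-- A (discrete) group is amenable if it has a left-invariant mean. -/
def IsAmenable (G : Type u) [Group G] : Prop :=
  ∃ m : lp (fun _ : G => ℝ) ∞ →ₗ[ℝ] ℝ, IsMean m ∧ ∀ g : G, InvariantUnder m (fun x => g * x)

open Classical in
/-- A (discrete) group is inner amenable if it has a conjugation-invariant mean that gives the
identity element mass zero (that is, a conjugation-invariant mean on `G \ {1}`). -/
def IsInnerAmenable (G : Type u) [Group G] : Prop :=
  ∃ m : lp (fun _ : G => ℝ) ∞ →ₗ[ℝ] ℝ, IsMean m ∧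
    (∀ g : G, InvariantUnder m (fun x => g * x * g⁻¹)) ∧
    m (lp.single ∞ (1 : G) (1 : ℝ)) = 0

/-! ### Orthogonal representations -/

/-- An orthogonal representation of `G` on the real inner product space `H`. -/
abbrev OrthRep (G : Type u) [Group G] (H : Type v) [NormedAddCommGroup H]
    [InnerProductSpace ℝ H] := G →* (H ≃ₗᵢ[ℝ] H)

/-- The real Hilbert space `ℓ²(G)`. -/
abbrev RealL2 (G : Type u) := lp (fun _ : G => ℝ) 2

theorem memlp_comp_equiv {X : Type u} (e : X ≃ X) (f : RealL2 X) :
    Memℓp (fun x => f (e x)) 2 := by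
  have h := lp.memℓp f
  rw [memℓp_gen_iff (by norm_num)] at h ⊢
  exact (e.summable_iff (f := fun i => ‖f i‖ ^ (2 : ℝ≥0∞).toReal)).2 h

/-- Left translation on `ℓ²(G)`: `(λ_g f)(x) = f (g⁻¹ x)`. -/
noncomputable def leftTranslate {G : Type u} [Group G] (g : G) : RealL2 G →ₗᵢ[ℝ] RealL2 G where
  toFun f := ⟨fun x => f (g⁻¹ * x), memlp_comp_equiv (Equiv.mulLeft g⁻¹) f⟩
  map_add' _ _ := by ext; rfl
  map_smul' _ _ := by ext; rfl
  norm_map' f := by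
    rw [lp.norm_eq_tsum_rpow (by norm_num), lp.norm_eq_tsum_rpow (by norm_num)]
    congr 1
    exact (Equiv.mulLeft g⁻¹).tsum_eq (fun i => ‖f i‖ ^ (2 : ℝ≥0∞).toReal)

@[simp] theorem leftTranslate_apply {G : Type u} [Group G] (g : G) (f : RealL2 G) (x : G) :
    leftTranslate g f x = f (g⁻¹ * x) := rfl

/-- The real left regular representation of `G` on `ℓ²(G)`. -/
noncomputable def leftRegular (G : Type u) [Group G] : OrthRep G (RealL2 G) where
  toFun g :=
    { toLinearEquiv := LinearEquiv.ofLinearMap (leftTranslate g).toLinearMap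
        (leftTranslate g⁻¹).toLinearMap
        (by ext f x; simp) (by ext f x; simp)
      norm_map' := (leftTranslate g).norm_map }
  map_one' := by ext f x; change f (1⁻¹ * x) = f x; simp
  map_mul' g h := by
    ext f x; change f ((g * h)⁻¹ * x) = f (h⁻¹ * (g⁻¹ * x)); simp [mul_assoc]

@[simp] theorem leftRegular_apply {G : Type u} [Group G] (g : G) (f : RealL2 G) (x : G) :
    leftRegular G g f x = f (g⁻¹ * x) := rfl

/-- `π` is mixing: every matrix coefficient vanishes at infinity. -/
def IsMixing {G : Type u} [Group G] {H : Type v} [NormedAddCommGroup H] [InnerProductSpace ℝ H]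
    (π : OrthRep G H) : Prop :=
  ∀ ξ η : H, Tendsto (fun g : G => inner ℝ (π g ξ) η) cofinite (𝓝 0)

/-- `π` is weakly contained in `ρ`: every diagonal matrix coefficient of `π` is approximated,
uniformly on finite subsets of `G`, by finite sums of diagonal matrix coefficients of `ρ`. -/
def WeaklyContained {G : Type u} [Group G] {H : Type v} [NormedAddCommGroup H]
    [InnerProductSpace ℝ H] {K : Type w} [NormedAddCommGroup K] [InnerProductSpace ℝ K]
    (π : OrthRep G H) (ρ : OrthRep G K) : Prop :=
  ∀ (ξ : H) (E : Finset G) (ε : ℝ), 0 < ε →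
    ∃ (n : ℕ) (η : Fin n → K), ∀ g ∈ E,
      |inner ℝ (π g ξ) ξ - ∑ i, inner ℝ (ρ g (η i)) (η i)| < ε

/-- `π` is weakly-`ℓ²`: it is weakly contained in the left regular representation. -/
def IsWeaklyL2 {G : Type u} [Group G] {H : Type v} [NormedAddCommGroup H] [InnerProductSpace ℝ H]
    (π : OrthRep G H) : Prop :=
  WeaklyContained π (leftRegular G)

/-! ### Quasi-cocycles and the class `NC₁` -/

/-- `q` is a quasi-cocycle for `π`. -/
def IsQuasiCocycle {G : Type u} [Group G] {H : Type v} [NormedAddCommGroup H]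
    [InnerProductSpace ℝ H] (π : OrthRep G H) (q : G → H) : Prop :=
  ∃ C : ℝ, ∀ g h : G, ‖q (g * h) - q g - π g (q h)‖ ≤ C

/-- The set of unbounded, anti-symmetric quasi-cocycles for `π`. -/
def QHas {G : Type u} [Group G] {H : Type v} [NormedAddCommGroup H] [InnerProductSpace ℝ H]
    (π : OrthRep G H) : Set (G → H) :=
  {q | IsQuasiCocycle π q ∧ (∀ g : G, q g = -π g (q g⁻¹)) ∧ ¬ ∃ C : ℝ, ∀ g : G, ‖q g‖ ≤ C}

/-- The class `NC₁`. The Hilbert space may be taken in the universe of `G`, because the closed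
linear span of the range of a quasi-cocycle and its translates is an invariant subspace of
density at most that of `G`. -/
def IsNC1 (G : Type u) [Group G] : Prop :=
  ¬ IsAmenable G ∧
    ∃ (H : Type u) (_ : NormedAddCommGroup H) (_ : InnerProductSpace ℝ H) (_ : CompleteSpace H)
      (π : OrthRep G H), IsWeaklyL2 π ∧ IsMixing π ∧ (QHas π).Nonempty

/-! ### Conjugation orbits -/

/-- The orbit of `g` under the conjugation action of the subgroup `S` on `G`. -/
def conjOrbit {G : Type u} [Group G] (S : Subgroup G) (g : G) : Set G :=
  Set.range (fun s : S => (s : G) * g * (s : G)⁻¹)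

/-- `G` is icc: it is infinite and every conjugacy class other than `{1}` is infinite. -/
def IsICC (G : Type u) [Group G] : Prop :=
  Infinite G ∧ ∀ g : G, g ≠ 1 → (conjugatesOf g).Infinite

end GroupNC

/-! Anti-symmetry puts `q (g * h * g⁻¹)` within `2 * C` of `π g (q h) + q g - π (g * h * g⁻¹) (q g)`
(`norm_conj_le`). So for fixed `g`, the map `q` intertwines conjugation with `π` up to an error
bounded in `h`, which becomes negligible after normalization wherever `‖q h‖` is large.

The core is `IsNC1.isAmenable_of_mean`: conjugation by a non-amenable normal subgroup `S` preserves
no atomless mean. Mixing enters through `isNull_sublevel`: `q` is unbounded on an infinite normal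
`S` (`bounded_of_bounded_on_normal`), so a sublevel set of `‖q‖` has infinitely many conjugates by
`S` with pairwise finite intersections, and an atomless invariant mean must give it mass zero. Weak
containment enters through `isAmenable_of_isNull_sublevel`: it supplies positive forms on a dense
part of `H`, on which `ℓ^∞(G)` acts as by multiplication on `ℓ²(G)`. Each `q h` then gives a state
on `ℓ^∞(G)`, and averaging these states over `h` yields an `S`-invariant mean on `G`.

Infinitely many finite orbits would produce an atomless invariant mean by averaging their uniform
measures along a non-principal ultrafilter. Hence the FC-centre is finite, its quotient is icc, and
in the torsion free case it is trivial. On an icc group a conjugation invariant mean vanishing at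
`1` has no atoms, which excludes inner amenability. -/

namespace GroupNC

/-! ### Means as functionals on bounded functions -/

/-- A real function is bounded. -/
def IsBdd {X : Type u} (f : X → ℝ) : Prop := ∃ C : ℝ, ∀ x, |f x| ≤ C

namespace IsBdd

variable {X : Type u} {f g : X → ℝ}

theorem memlp (hf : IsBdd f) : Memℓp f ∞ := by
  obtain ⟨C, hC⟩ := hf
  exact memℓp_infty ⟨C, by rintro _ ⟨x, rfl⟩; exact hC x⟩

theorem add (hf : IsBdd f) (hg : IsBdd g) : IsBdd (fun x => f x + g x) := by
  obtain ⟨C, hC⟩ := hf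
  obtain ⟨D, hD⟩ := hg
  exact ⟨C + D, fun x => (abs_add_le _ _).trans (add_le_add (hC x) (hD x))⟩

theorem const_mul (c : ℝ) (hf : IsBdd f) : IsBdd (fun x => c * f x) := by
  obtain ⟨C, hC⟩ := hf
  exact ⟨|c| * C, fun x => by
    rw [abs_mul]; exact mul_le_mul_of_nonneg_left (hC x) (abs_nonneg c)⟩

theorem const (c : ℝ) : IsBdd (fun _ : X => c) := ⟨|c|, fun _ => le_rfl⟩

theorem comp {Y : Type v} (hf : IsBdd f) (φ : Y → X) : IsBdd (fun y => f (φ y)) := by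
  obtain ⟨C, hC⟩ := hf
  exact ⟨C, fun y => hC _⟩

theorem sum {ι : Type v} (s : Finset ι) {F : ι → X → ℝ} (h : ∀ i ∈ s, IsBdd (F i)) :
    IsBdd (fun x => ∑ i ∈ s, F i x) := by
  choose! C hC using h
  exact ⟨∑ i ∈ s, C i, fun x => (Finset.abs_sum_le_sum_abs _ _).trans
    (Finset.sum_le_sum fun i hi => hC i hi x)⟩

theorem indicator (A : Set X) : IsBdd (A.indicator (fun _ => (1 : ℝ))) := by
  refine ⟨1, fun x => ?_⟩
  by_cases h : x ∈ A <;> simp [h]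

end IsBdd

theorem abs_le_norm_linf {X : Type u} (f : lp (fun _ : X => ℝ) ∞) (x : X) : |f x| ≤ ‖f‖ :=
  lp.norm_apply_le_norm (by simp) f x

theorem isBdd_linf {X : Type u} (f : lp (fun _ : X => ℝ) ∞) : IsBdd (fun x => f x) :=
  ⟨‖f‖, abs_le_norm_linf f⟩

open Classical in
/-- A bounded function as an element of `ℓ^∞`; the value is `0` for unbounded functions. -/
noncomputable def toLinf {X : Type u} (f : X → ℝ) : lp (fun _ : X => ℝ) ∞ :=
  if h : IsBdd f then ⟨f, h.memlp⟩ else 0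

theorem toLinf_apply {X : Type u} {f : X → ℝ} (hf : IsBdd f) (x : X) : toLinf f x = f x := by
  rw [toLinf, dif_pos hf]

theorem toLinf_coe {X : Type u} (f : lp (fun _ : X => ℝ) ∞) : toLinf (fun x => f x) = f := by
  ext x; exact toLinf_apply (isBdd_linf f) x

section Mean

variable {X : Type u} {m : lp (fun _ : X => ℝ) ∞ →ₗ[ℝ] ℝ} {f g : X → ℝ}

theorem mean_add (hf : IsBdd f) (hg : IsBdd g) :
    m (toLinf (fun x => f x + g x)) = m (toLinf f) + m (toLinf g) := by
  rw [← map_add]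
  congr 1
  ext x
  simp [toLinf_apply hf, toLinf_apply hg, toLinf_apply (hf.add hg)]

theorem mean_const_mul (c : ℝ) (hf : IsBdd f) :
    m (toLinf (fun x => c * f x)) = c * m (toLinf f) := by
  rw [← smul_eq_mul, ← map_smul]
  congr 1
  ext x
  simp [toLinf_apply hf, toLinf_apply (hf.const_mul c)]

theorem mean_sum {ι : Type v} (s : Finset ι) {F : ι → X → ℝ} (h : ∀ i ∈ s, IsBdd (F i)) :
    m (toLinf (fun x => ∑ i ∈ s, F i x)) = ∑ i ∈ s, m (toLinf (F i)) := by
  rw [← map_sum]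
  congr 1
  ext x
  rw [toLinf_apply (IsBdd.sum s h), lp.coeFn_sum, Finset.sum_apply]
  exact Finset.sum_congr rfl fun i hi => (toLinf_apply (h i hi) x).symm

theorem mean_const (hm : IsMean m) (c : ℝ) : m (toLinf (fun _ => c)) = c := by
  have h : toLinf (fun _ : X => c) = c • (1 : lp (fun _ : X => ℝ) ∞) := by
    ext x
    rw [toLinf_apply (IsBdd.const c)]
    simp
  rw [h, map_smul, hm.2, smul_eq_mul, mul_one]

theorem mean_mono (hm : IsMean m) (hf : IsBdd f) (hg : IsBdd g) (h : ∀ x, f x ≤ g x) :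
    m (toLinf f) ≤ m (toLinf g) := by
  rw [← sub_nonneg, ← map_sub]
  refine hm.1 _ fun x => ?_
  simpa [toLinf_apply hf, toLinf_apply hg] using h x

theorem mean_nonneg (hm : IsMean m) (hf : IsBdd f) (h : ∀ x, 0 ≤ f x) : 0 ≤ m (toLinf f) :=
  hm.1 _ fun x => by rw [toLinf_apply hf]; exact h x

theorem mean_comp {φ : X → X} (hφ : InvariantUnder m φ) (hf : IsBdd f) :
    m (toLinf (fun x => f (φ x))) = m (toLinf f) :=
  hφ _ _ fun x => by rw [toLinf_apply hf, toLinf_apply (hf.comp φ)]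

/-- A set has mean zero. -/
def IsNull (m : lp (fun _ : X => ℝ) ∞ →ₗ[ℝ] ℝ) (A : Set X) : Prop :=
  m (toLinf (A.indicator (fun _ => (1 : ℝ)))) = 0

theorem mean_indicator_mono (hm : IsMean m) {A B : Set X} (h : A ⊆ B) :
    m (toLinf (A.indicator (fun _ => (1 : ℝ)))) ≤ m (toLinf (B.indicator (fun _ => (1 : ℝ)))) :=
  mean_mono hm (.indicator A) (.indicator B)
    fun x => Set.indicator_le_indicator_of_subset h (fun _ => zero_le_one) x

theorem mean_indicator_nonneg (hm : IsMean m) (A : Set X) :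
    0 ≤ m (toLinf (A.indicator (fun _ => (1 : ℝ)))) :=
  mean_nonneg hm (.indicator A) fun x => Set.indicator_nonneg (fun _ _ => zero_le_one) x

theorem IsNull.mono (hm : IsMean m) {A B : Set X} (hB : IsNull m B) (h : A ⊆ B) : IsNull m A :=
  le_antisymm ((mean_indicator_mono hm h).trans hB.le) (mean_indicator_nonneg hm A)

theorem IsNull.biUnion (hm : IsMean m) {ι : Type v} (s : Finset ι) {A : ι → Set X}
    (h : ∀ i ∈ s, IsNull m (A i)) : IsNull m (⋃ i ∈ s, A i) := by
  refine le_antisymm ?_ (mean_indicator_nonneg hm _)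
  have key : m (toLinf (fun x => ∑ i ∈ s, (A i).indicator (fun _ => (1 : ℝ)) x)) = 0 := by
    rw [mean_sum _ fun i _ => IsBdd.indicator (A i)]
    exact Finset.sum_eq_zero fun i hi => h i hi
  rw [← key]
  refine mean_mono hm (.indicator _) (IsBdd.sum _ fun i _ => .indicator (A i)) fun x => ?_
  have hnn : ∀ i ∈ s, 0 ≤ (A i).indicator (fun _ => (1 : ℝ)) x :=
    fun i _ => Set.indicator_nonneg (fun _ _ => zero_le_one) x
  by_cases hx : x ∈ ⋃ i ∈ s, A i
  · rw [Set.indicator_of_mem hx]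
    simp only [Set.mem_iUnion] at hx
    obtain ⟨i, hi, hxi⟩ := hx
    have := Finset.single_le_sum hnn hi
    rwa [Set.indicator_of_mem hxi] at this
  · rw [Set.indicator_of_notMem hx]
    exact Finset.sum_nonneg hnn

theorem isNull_of_finite (hm : IsMean m) (h : ∀ x, IsNull m {x}) {A : Set X} (hA : A.Finite) :
    IsNull m A :=
  (IsNull.biUnion hm hA.toFinset (A := fun x => {x}) fun x _ => h x).mono hm fun x hx => by
    simpa using hx

theorem mean_le_add_of_null (hm : IsMean m) (hf : IsBdd f) (hg : IsBdd g) {A : Set X}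
    (hA : IsNull m A) {ε : ℝ} (hε : 0 ≤ ε) (h : ∀ x ∉ A, f x ≤ g x + ε) :
    m (toLinf f) ≤ m (toLinf g) + ε := by
  obtain ⟨C, hC⟩ := hf
  obtain ⟨D, hD⟩ := hg
  have hf : IsBdd f := ⟨C, hC⟩
  have hg : IsBdd g := ⟨D, hD⟩
  -- On `A` the crude estimate `f ≤ g + (C + D)` is used; it costs nothing because `A` has mean
  -- zero.
  have h1 := mean_mono hm hf ((hg.add (.const ε)).add ((IsBdd.indicator A).const_mul (C + D)))
    fun x => by
      by_cases hx : x ∈ A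
      · simp only [Set.indicator_of_mem hx]
        linarith [(abs_le.1 (hC x)).2, (abs_le.1 (hD x)).1]
      · simp only [Set.indicator_of_notMem hx]
        linarith [h x hx]
  rw [mean_add (hg.add (.const ε)) ((IsBdd.indicator A).const_mul (C + D)),
    mean_add hg (.const ε), mean_const hm, mean_const_mul _ (.indicator A)] at h1
  rw [show m (toLinf (A.indicator (fun _ => (1 : ℝ)))) = 0 from hA] at h1
  linarith

theorem mean_eq_of_null (hm : IsMean m) (hf : IsBdd f) (hg : IsBdd g)
    (h : ∀ ε : ℝ, 0 < ε → ∃ A : Set X, IsNull m A ∧ ∀ x ∉ A, |f x - g x| ≤ ε) :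
    m (toLinf f) = m (toLinf g) := by
  refine le_antisymm (le_of_forall_pos_le_add fun ε hε => ?_)
    (le_of_forall_pos_le_add fun ε hε => ?_) <;> obtain ⟨A, hA, hfg⟩ := h ε hε
  · exact mean_le_add_of_null hm hf hg hA hε.le fun x hx => by
      linarith [(abs_le.1 (hfg x hx)).2]
  · exact mean_le_add_of_null hm hg hf hA hε.le fun x hx => by
      linarith [(abs_le.1 (hfg x hx)).1]

/-- If infinitely many sets of the same mass are disjoint up to null sets, the mass is zero. -/
theorem isNull_of_almost_disjoint (hm : IsMean m) {A : Set X} (B : ℕ → Set X)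
    (hB : ∀ n, m (toLinf ((B n).indicator (fun _ => (1 : ℝ))))
      = m (toLinf (A.indicator (fun _ => (1 : ℝ)))))
    (hd : ∀ i j, i < j → IsNull m (B i ∩ B j)) : IsNull m A := by
  set c := m (toLinf (A.indicator (fun _ => (1 : ℝ)))) with hc
  have hc0 : 0 ≤ c := mean_indicator_nonneg hm A
  -- Off the null union of pairwise intersections at most one indicator is nonzero, so the first `N`
  -- sum to at most `1`.
  have main : ∀ N : ℕ, N * c ≤ 1 := by
    intro N
    set T := ((Finset.range N) ×ˢ (Finset.range N)).filter fun p => p.1 < p.2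
    have hE : IsNull m (⋃ p ∈ T, B p.1 ∩ B p.2) :=
      IsNull.biUnion hm T fun p hp => hd _ _ (Finset.mem_filter.1 hp).2
    have h1 := mean_le_add_of_null (f := fun x => ∑ i ∈ Finset.range N,
      (B i).indicator (fun _ => (1 : ℝ)) x) (g := fun _ => 1) hm
      (IsBdd.sum _ fun i _ => .indicator (B i)) (.const 1) hE le_rfl fun x hx => by
        by_cases hex : ∃ i ∈ Finset.range N, x ∈ B i
        · obtain ⟨i, hi, hxi⟩ := hex
          rw [Finset.sum_eq_single_of_mem i hi, Set.indicator_of_mem hxi]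
          · simp
          · intro j hj hji
            refine Set.indicator_of_notMem (fun hxj => hx ?_) _
            simp only [Set.mem_iUnion]
            rcases lt_or_gt_of_ne hji with hlt | hlt
            · exact ⟨(j, i), by simpa [T, hlt] using ⟨Finset.mem_range.1 hj, Finset.mem_range.1 hi⟩,
                hxj, hxi⟩
            · exact ⟨(i, j), by simpa [T, hlt] using ⟨Finset.mem_range.1 hi, Finset.mem_range.1 hj⟩,
                hxi, hxj⟩
        · push Not at hex
          rw [Finset.sum_eq_zero fun i hi => Set.indicator_of_notMem (hex i hi) _]
          simp
    rw [mean_sum _ fun i _ => IsBdd.indicator (B i), mean_const hm,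
      Finset.sum_congr rfl fun i _ => hB i] at h1
    simpa using h1
  refine le_antisymm (not_lt.1 fun hpos => ?_) hc0
  obtain ⟨N, hN⟩ := exists_nat_gt (1 / c)
  rw [div_lt_iff₀ hpos] at hN
  exact absurd (main N) (not_le.2 hN)

end Mean

/-- Every proper filter carries a mean extending the limit functional along the filter. -/
theorem exists_mean_of_filter {X : Type u} (l : Filter X) [l.NeBot] :
    ∃ m : lp (fun _ : X => ℝ) ∞ →ₗ[ℝ] ℝ, IsMean m ∧
      ∀ f : X → ℝ, IsBdd f → ∀ a, Tendsto f l (𝓝 a) → m (toLinf f) = a := by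
  -- Along an ultrafilter every bounded function converges, by compactness of `[-‖f‖, ‖f‖]`.
  set U := Ultrafilter.of l
  have hlim : ∀ f : lp (fun _ : X => ℝ) ∞, ∃ a, Tendsto (fun x => f x) U (𝓝 a) := by
    intro f
    obtain ⟨a, -, ha⟩ := (isCompact_Icc (a := -‖f‖) (b := ‖f‖)).ultrafilter_le_nhds
      (U.map fun x => f x) (by
        rw [Ultrafilter.coe_map, le_principal_iff, mem_map]
        exact univ_mem' fun x => abs_le.1 (abs_le_norm_linf f x))
    exact ⟨a, ha⟩
  choose L hL using hlim
  refine ⟨⟨⟨L, fun f g => ?_⟩, fun c f => ?_⟩, ⟨fun f hf => ?_, ?_⟩, fun f hf a ha => ?_⟩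
  · exact tendsto_nhds_unique (hL (f + g)) ((hL f).add (hL g))
  · exact tendsto_nhds_unique (hL (c • f)) ((hL f).const_mul c)
  · exact ge_of_tendsto' (hL f) hf
  · exact tendsto_nhds_unique (hL 1) tendsto_const_nhds
  · refine tendsto_nhds_unique (hL (toLinf f)) ?_
    have h : (fun x => toLinf f x) = f := funext (toLinf_apply hf)
    rw [h]
    exact ha.mono_left (Ultrafilter.of_le l)

/-- A functional on bounded functions, given by a mean of functionals depending on a point. -/
noncomputable def mixMean {X : Type u} {Y : Type v} (m : lp (fun _ : X => ℝ) ∞ →ₗ[ℝ] ℝ)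
    (μ : X → lp (fun _ : Y => ℝ) ∞ →ₗ[ℝ] ℝ) (hμ : ∀ f, IsBdd (fun x => μ x f)) :
    lp (fun _ : Y => ℝ) ∞ →ₗ[ℝ] ℝ where
  toFun f := m (toLinf (fun x => μ x f))
  map_add' f g := by simp only [map_add]; exact mean_add (hμ f) (hμ g)
  map_smul' c f := by
    simp only [map_smul, smul_eq_mul, RingHom.id_apply]; exact mean_const_mul c (hμ f)

/-! ### Amenability -/

/-- The average over a finite set. -/
noncomputable def finsetAverage {X : Type u} (s : Finset X) : lp (fun _ : X => ℝ) ∞ →ₗ[ℝ] ℝ where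
  toFun f := (s.card : ℝ)⁻¹ * ∑ x ∈ s, f x
  map_add' f g := by rw [← mul_add, ← Finset.sum_add_distrib]; rfl
  map_smul' c f := by simp [← Finset.mul_sum, mul_left_comm]

theorem finsetAverage_apply {X : Type u} (s : Finset X) (f : lp (fun _ : X => ℝ) ∞) :
    finsetAverage s f = (s.card : ℝ)⁻¹ * ∑ x ∈ s, f x := rfl

theorem isMean_finsetAverage {X : Type u} {s : Finset X} (hs : s.Nonempty) :
    IsMean (finsetAverage s) := by
  refine ⟨fun f hf => mul_nonneg (by positivity) (Finset.sum_nonneg fun x _ => hf x), ?_⟩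
  have : (s.card : ℝ) ≠ 0 := by exact_mod_cast hs.card_pos.ne'
  simp [finsetAverage_apply, this]

theorem IsMean.abs_le_norm {X : Type u} {m : lp (fun _ : X => ℝ) ∞ →ₗ[ℝ] ℝ} (hm : IsMean m)
    (f : lp (fun _ : X => ℝ) ∞) : |m f| ≤ ‖f‖ := by
  have h1 := mean_mono hm (isBdd_linf f) (.const ‖f‖) fun x => (abs_le.1 (abs_le_norm_linf f x)).2
  have h2 := mean_mono hm (.const (-‖f‖)) (isBdd_linf f) fun x =>
    (abs_le.1 (abs_le_norm_linf f x)).1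
  rw [mean_const hm, toLinf_coe] at h1 h2
  exact abs_le.2 ⟨h2, h1⟩

theorem isAmenable_of_finite (G : Type u) [Group G] [Finite G] : IsAmenable G := by
  have := Fintype.ofFinite G
  refine ⟨finsetAverage Finset.univ, isMean_finsetAverage Finset.univ_nonempty, fun g f f' h => ?_⟩
  simp only [finsetAverage_apply, h]
  congr 1
  exact Equiv.sum_comp (Equiv.mulLeft g) fun x => f x

/-- If `φ : X → Y` intertwines the left translations on a group `Y` with maps preserving a mean
on `X`, then `Y` is amenable. -/
theorem isAmenable_of_equivariant {X : Type u} {Y : Type v} [Group Y]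
    {m : lp (fun _ : X => ℝ) ∞ →ₗ[ℝ] ℝ} (hm : IsMean m) (act : Y → X → X)
    (hinv : ∀ y, InvariantUnder m (act y)) (φ : X → Y) (hφ : ∀ y x, φ (act y x) = y * φ x) :
    IsAmenable Y := by
  let μ : X → lp (fun _ : Y => ℝ) ∞ →ₗ[ℝ] ℝ := fun x =>
    { toFun := fun f => f (φ x), map_add' := fun _ _ => rfl, map_smul' := fun _ _ => rfl }
  have hμ : ∀ f, IsBdd (fun x => μ x f) := fun f => (isBdd_linf f).comp φ
  refine ⟨mixMean m μ hμ, ⟨fun f hf => mean_nonneg hm (hμ f) fun x => hf _, mean_const hm 1⟩,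
    fun y f f' h => ?_⟩
  refine Eq.trans ?_ (mean_comp (hinv y) (hμ f))
  change m (toLinf fun x => f' (φ x)) = m (toLinf fun x => f (φ (act y x)))
  simp only [h, hφ]

/-- With `t x` a representative of the right coset of `x`, the map `x ↦ x * (t x)⁻¹` is a left
`S`-equivariant map from `G` to `S`, along which the mean is pushed forward. -/
theorem isAmenable_subgroup_of_mean {G : Type u} [Group G] (S : Subgroup G)
    {m : lp (fun _ : G => ℝ) ∞ →ₗ[ℝ] ℝ} (hm : IsMean m)
    (hinv : ∀ s ∈ S, InvariantUnder m (fun x => s * x)) : IsAmenable S := by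
  let t : G → G := fun x => (Quotient.mk (QuotientGroup.rightRel S) x).out
  have ht : ∀ x, x * (t x)⁻¹ ∈ S := fun x => by
    have := Quotient.mk_out (s := QuotientGroup.rightRel S) x
    exact QuotientGroup.rightRel_apply.1 this
  have hts : ∀ s : S, ∀ x, t (s * x) = t x := fun s x => by
    have : (Quotient.mk (QuotientGroup.rightRel S) (s * x)) =
        Quotient.mk (QuotientGroup.rightRel S) x :=
      Quotient.sound (QuotientGroup.rightRel_apply.2 (by simp))
    simp only [t, this]
  refine isAmenable_of_equivariant hm (fun (s : S) x => (s : G) * x) (fun s => hinv s s.2)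
    (fun x => ⟨x * (t x)⁻¹, ht x⟩) fun s x => Subtype.ext ?_
  simp [hts, mul_assoc]

theorem isAmenable_of_top {G : Type u} [Group G] (h : IsAmenable (⊤ : Subgroup G)) :
    IsAmenable G := by
  obtain ⟨m, hm, hinv⟩ := h
  exact isAmenable_of_equivariant hm (fun g x => (⟨g, trivial⟩ : (⊤ : Subgroup G)) * x)
    (fun g => hinv ⟨g, trivial⟩) (fun x => (x : G)) fun g x => rfl

/-! ### Weighted inner products on `ℓ²` -/

section Weighted

variable {X : Type u}

theorem summable_mul_l2 (u v : RealL2 X) : Summable (fun x => u x * v x) := by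
  simpa [mul_comm] using lp.summable_inner (𝕜 := ℝ) u v

theorem summable_weighted (f : lp (fun _ : X => ℝ) ∞) (u v : RealL2 X) :
    Summable (fun x => f x * (u x * v x)) := by
  refine Summable.of_norm_bounded ((summable_mul_l2 u v).abs.mul_left ‖f‖) fun x => ?_
  rw [Real.norm_eq_abs, abs_mul]
  exact mul_le_mul_of_nonneg_right (abs_le_norm_linf f x) (abs_nonneg _)

theorem l2_norm_sq (u : RealL2 X) : ∑' x, u x * u x = ‖u‖ ^ 2 := by
  rw [← real_inner_self_eq_norm_sq, lp.inner_eq_tsum]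
  simp [sq]

/-- The bilinear form `(u, v) ↦ ∑ f u v` on `ℓ²`. -/
noncomputable def weighted (f : lp (fun _ : X => ℝ) ∞) : RealL2 X →ₗ[ℝ] RealL2 X →ₗ[ℝ] ℝ :=
  LinearMap.mk₂ ℝ (fun u v => ∑' x, f x * (u x * v x))
    (fun u u' v => by
      rw [← (summable_weighted f u v).tsum_add (summable_weighted f u' v)]
      exact tsum_congr fun x => by rw [lp.coeFn_add, Pi.add_apply]; ring)
    (fun c u v => by
      rw [smul_eq_mul, ← tsum_mul_left]
      exact tsum_congr fun x => by rw [lp.coeFn_smul, Pi.smul_apply, smul_eq_mul]; ring)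
    (fun u v v' => by
      rw [← (summable_weighted f u v).tsum_add (summable_weighted f u v')]
      exact tsum_congr fun x => by rw [lp.coeFn_add, Pi.add_apply]; ring)
    (fun c u v => by
      rw [smul_eq_mul, ← tsum_mul_left]
      exact tsum_congr fun x => by rw [lp.coeFn_smul, Pi.smul_apply, smul_eq_mul]; ring)

theorem weighted_apply (f : lp (fun _ : X => ℝ) ∞) (u v : RealL2 X) :
    weighted f u v = ∑' x, f x * (u x * v x) := rfl

theorem weighted_comm (f : lp (fun _ : X => ℝ) ∞) (u v : RealL2 X) :
    weighted f u v = weighted f v u := by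
  simp only [weighted_apply, mul_comm (u _)]

theorem weighted_add (f g : lp (fun _ : X => ℝ) ∞) (u v : RealL2 X) :
    weighted (f + g) u v = weighted f u v + weighted g u v := by
  simp only [weighted_apply]
  rw [← (summable_weighted f u v).tsum_add (summable_weighted g u v)]
  exact tsum_congr fun x => by rw [lp.coeFn_add, Pi.add_apply]; ring

theorem weighted_smul (c : ℝ) (f : lp (fun _ : X => ℝ) ∞) (u v : RealL2 X) :
    weighted (c • f) u v = c * weighted f u v := by
  simp only [weighted_apply]
  rw [← tsum_mul_left]
  exact tsum_congr fun x => by rw [lp.coeFn_smul, Pi.smul_apply, smul_eq_mul]; ring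

theorem weighted_one (u v : RealL2 X) : weighted 1 u v = inner ℝ u v := by
  rw [weighted_apply, lp.inner_eq_tsum]
  exact tsum_congr fun x => by simp [mul_comm]

theorem weighted_nonneg {f : lp (fun _ : X => ℝ) ∞} (hf : ∀ x, 0 ≤ f x) (u : RealL2 X) :
    0 ≤ weighted f u u :=
  tsum_nonneg fun x => mul_nonneg (hf x) (mul_self_nonneg _)

theorem abs_weighted_le (f : lp (fun _ : X => ℝ) ∞) (u v : RealL2 X) :
    |weighted f u v| ≤ ‖f‖ * (‖u‖ ^ 2 + ‖v‖ ^ 2) := by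
  rw [weighted_apply, ← Real.norm_eq_abs]
  have hs := ((summable_mul_l2 u u).add (summable_mul_l2 v v)).mul_left ‖f‖
  refine (tsum_of_norm_bounded hs.hasSum fun x => ?_).trans_eq ?_
  · rw [Real.norm_eq_abs, abs_mul]
    refine mul_le_mul (abs_le_norm_linf f x) ?_ (abs_nonneg _) (norm_nonneg _)
    rw [abs_le]
    constructor <;> nlinarith [sq_nonneg (u x + v x), sq_nonneg (u x - v x), mul_self_nonneg (u x),
      mul_self_nonneg (v x)]
  · rw [tsum_mul_left, (summable_mul_l2 u u).tsum_add (summable_mul_l2 v v), l2_norm_sq,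
      l2_norm_sq]

/-- Substitution `x ↦ s * x` in the sum. This is the source of the equivariance of all the forms
below. -/
theorem weighted_leftRegular {G : Type u} [Group G] (s : G) {f f' : lp (fun _ : G => ℝ) ∞}
    (h : ∀ x, f x = f' (s * x)) (u v : RealL2 G) :
    weighted f' (leftRegular G s u) (leftRegular G s v) = weighted f u v := by
  simp only [weighted_apply, leftRegular_apply]
  rw [← (Equiv.mulLeft s).tsum_eq]
  exact tsum_congr fun x => by simp [h]

end Weighted

/-! ### Equivariant positive forms coming from weak containment -/

section Forms

variable {G : Type u} [Group G] {H : Type v} [NormedAddCommGroup H] [InnerProductSpace ℝ H]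

/-- The linear map `ℝ[G] → H` sending `g` to `π g w`. -/
noncomputable def orbitMap (π : OrthRep G H) (w : H) : (G →₀ ℝ) →ₗ[ℝ] H :=
  Finsupp.linearCombination ℝ (fun g => π g w)

/-- Left translation on `ℝ[G]`. -/
noncomputable def shift (s : G) : (G →₀ ℝ) →ₗ[ℝ] (G →₀ ℝ) := Finsupp.lmapDomain ℝ ℝ (s * ·)

theorem orbitMap_shift (π : OrthRep G H) (w : H) (s : G) (a : G →₀ ℝ) :
    orbitMap π w (shift s a) = π s (orbitMap π w a) := by
  have : orbitMap π w ∘ₗ shift s = (π s).toLinearEquiv.toLinearMap ∘ₗ orbitMap π w := by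
    ext g
    simp [orbitMap, shift, Finsupp.mapDomain_single]
  exact LinearMap.congr_fun this a

theorem norm_orbitMap_le (π : OrthRep G H) (w : H) (a : G →₀ ℝ) :
    ‖orbitMap π w a‖ ≤ (∑ g ∈ a.support, |a g|) * ‖w‖ := by
  rw [orbitMap, Finsupp.linearCombination_apply, Finsupp.sum, Finset.sum_mul]
  refine (norm_sum_le _ _).trans (Finset.sum_le_sum fun g _ => ?_)
  rw [norm_smul, LinearIsometryEquiv.norm_map, Real.norm_eq_abs]

/-- A family of symmetric bilinear forms on `V`, indexed linearly and positively by `ℓ^∞(G)`, with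
`1` acting as the inner product pulled back along `ι : V → H`, and equivariant for maps
`sh g` that lift `π g`. -/
structure IsEquivariantForm (π : OrthRep G H) {V : Type w} [AddCommGroup V] [Module ℝ V]
    (ι : V →ₗ[ℝ] H) (sh : G → V →ₗ[ℝ] V)
    (B : lp (fun _ : G => ℝ) ∞ → V →ₗ[ℝ] V →ₗ[ℝ] ℝ) : Prop where
  lift : ∀ s a, ι (sh s a) = π s (ι a)
  add : ∀ f f' a b, B (f + f') a b = B f a b + B f' a b
  smul : ∀ (c : ℝ) f a b, B (c • f) a b = c * B f a b
  symm : ∀ f a b, B f a b = B f b a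
  nonneg : ∀ f, (∀ x, 0 ≤ f x) → ∀ a, 0 ≤ B f a a
  one : ∀ a b, B 1 a b = inner ℝ (ι a) (ι b)
  equivariant : ∀ s f f', (∀ x, f x = f' (s * x)) → ∀ a b, B f' (sh s a) (sh s b) = B f a b

theorem rep_mul_apply (π : OrthRep G H) (g k : G) (v : H) : π (g * k) v = π g (π k v) := by
  rw [map_mul]; rfl

theorem rep_one_apply (π : OrthRep G H) (v : H) : π 1 v = v := by
  rw [map_one]; rfl

theorem inner_rep (π : OrthRep G H) (w : H) (g k : G) :
    inner ℝ (π g w) (π k w) = inner ℝ (π (k⁻¹ * g) w) w := by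
  rw [← LinearIsometryEquiv.inner_map_map (π k) (π (k⁻¹ * g) w), ← rep_mul_apply,
    mul_inv_cancel_left]

/-- Weak containment in the regular representation gives equivariant forms on cyclic
subspaces. -/
theorem exists_equivariantForm_cyclic {π : OrthRep G H} (hπ : IsWeaklyL2 π) (w : H) :
    ∃ B, IsEquivariantForm π (orbitMap π w) shift B := by
  classical
  have hch : ∀ i : Finset G × ℕ, ∃ (n : ℕ) (η : Fin n → RealL2 G),
      ∀ g, g = 1 ∨ g ∈ i.1 →
        |inner ℝ (π g w) w - ∑ l, inner ℝ (leftRegular G g (η l)) (η l)| < 1 / ((i.2 : ℝ) + 1) := by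
    intro i
    -- Including `1` controls `∑ ‖η l‖ ^ 2`, which makes the approximating forms uniformly bounded
    -- so that a limit can be taken.
    obtain ⟨n, η, h⟩ := hπ w (insert 1 i.1) (1 / ((i.2 : ℝ) + 1)) (by positivity)
    exact ⟨n, η, fun g hg => h g (by simpa using hg)⟩
  choose n η hη using hch
  obtain ⟨m, hm, hlim⟩ := exists_mean_of_filter (atTop : Filter (Finset G × ℕ))
  have hnorm : ∀ i, ∑ l, ‖η i l‖ ^ 2 ≤ ‖w‖ ^ 2 + 1 := by
    intro i
    have h := hη i 1 (Or.inl rfl)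
    have h1 : 1 / ((i.2 : ℝ) + 1) ≤ 1 := by
      rw [div_le_one (by positivity)]; linarith [(Nat.cast_nonneg i.2 : (0 : ℝ) ≤ i.2)]
    simp only [map_one, LinearIsometryEquiv.coe_one, id_eq, real_inner_self_eq_norm_sq] at h
    linarith [(abs_lt.1 h).1]
  let T : ∀ i, Fin (n i) → (G →₀ ℝ) →ₗ[ℝ] RealL2 G := fun i l => orbitMap (leftRegular G) (η i l)
  let c : lp (fun _ : G => ℝ) ∞ → (G →₀ ℝ) → (G →₀ ℝ) → Finset G × ℕ → ℝ :=
    fun f a b i => ∑ l, weighted f (T i l a) (T i l b)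
  have hc : ∀ f a b, IsBdd (c f a b) := by
    intro f a b
    set A := ∑ g ∈ a.support, |a g|
    set B := ∑ g ∈ b.support, |b g|
    refine ⟨‖f‖ * ((A ^ 2 + B ^ 2) * (‖w‖ ^ 2 + 1)), fun i => ?_⟩
    calc |c f a b i| ≤ ∑ l, |weighted f (T i l a) (T i l b)| := Finset.abs_sum_le_sum_abs _ _
      _ ≤ ∑ l, ‖f‖ * ((A ^ 2 + B ^ 2) * ‖η i l‖ ^ 2) := by
        refine Finset.sum_le_sum fun l _ => (abs_weighted_le _ _ _).trans ?_
        refine mul_le_mul_of_nonneg_left ?_ (norm_nonneg _)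
        rw [add_mul, ← mul_pow, ← mul_pow]
        exact add_le_add (pow_le_pow_left₀ (norm_nonneg _) (norm_orbitMap_le _ _ _) 2)
          (pow_le_pow_left₀ (norm_nonneg _) (norm_orbitMap_le _ _ _) 2)
      _ = ‖f‖ * ((A ^ 2 + B ^ 2) * ∑ l, ‖η i l‖ ^ 2) := by rw [Finset.mul_sum, Finset.mul_sum]
      _ ≤ _ := by
        refine mul_le_mul_of_nonneg_left (mul_le_mul_of_nonneg_left (hnorm i) ?_) (norm_nonneg _)
        positivity
  let B : lp (fun _ : G => ℝ) ∞ → (G →₀ ℝ) →ₗ[ℝ] (G →₀ ℝ) →ₗ[ℝ] ℝ := fun f =>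
    LinearMap.mk₂ ℝ (fun a b => m (toLinf (c f a b)))
      (fun a a' b => by
        rw [← mean_add (hc f a b) (hc f a' b)]
        congr 2; ext i; simp [c, Finset.sum_add_distrib])
      (fun r a b => by
        rw [smul_eq_mul, ← mean_const_mul r (hc f a b)]
        congr 2; ext i; simp [c, Finset.mul_sum])
      (fun a b b' => by
        rw [← mean_add (hc f a b) (hc f a b')]
        congr 2; ext i; simp [c, Finset.sum_add_distrib])
      (fun r a b => by
        rw [smul_eq_mul, ← mean_const_mul r (hc f a b)]
        congr 2; ext i; simp [c, Finset.mul_sum])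
  have hB : ∀ f a b, B f a b = m (toLinf (c f a b)) := fun _ _ _ => rfl
  refine ⟨B, orbitMap_shift π w, ?_, ?_, ?_, ?_, ?_, ?_⟩
  · intro f f' a b
    rw [hB, hB, hB, ← mean_add (hc f a b) (hc f' a b)]
    congr 2; ext i; simp [c, weighted_add, Finset.sum_add_distrib]
  · intro r f a b
    rw [hB, hB, ← mean_const_mul r (hc f a b)]
    congr 2; ext i; simp [c, weighted_smul, Finset.mul_sum]
  · intro f a b
    rw [hB, hB]
    congr 2; ext i; exact Finset.sum_congr rfl fun l _ => weighted_comm _ _ _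
  · exact fun f hf a => mean_nonneg hm (hc f a a) fun i =>
      Finset.sum_nonneg fun l _ => weighted_nonneg hf _
  -- On basis vectors `g`, `k` both sides are governed by the matrix coefficient at `k⁻¹ * g`, which
  -- the finite set eventually contains.
  · have hone : B 1 = (innerₗ H).compl₁₂ (orbitMap π w) (orbitMap π w) := by
      ext g k
      simp only [LinearMap.coe_comp, Function.comp_apply, Finsupp.lsingle_apply,
        LinearMap.compl₁₂_apply, innerₗ_apply_apply, hB]
      refine hlim _ (hc _ _ _) _ ?_
      rw [Metric.tendsto_atTop]
      intro ε hε
      obtain ⟨N, hN⟩ := exists_nat_one_div_lt hε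
      refine ⟨({k⁻¹ * g}, N), fun i hi => ?_⟩
      have h1 := hη i (k⁻¹ * g) (Or.inr (hi.1 (by simp)))
      rw [dist_comm, Real.dist_eq]
      have h2 : c 1 (Finsupp.single g 1) (Finsupp.single k 1) i
          = ∑ l, inner ℝ (leftRegular G (k⁻¹ * g) (η i l)) (η i l) :=
        Finset.sum_congr rfl fun l _ => by
          simp only [T, orbitMap, Finsupp.linearCombination_single, one_smul, weighted_one]
          exact inner_rep _ _ _ _
      rw [h2]
      simp only [orbitMap, Finsupp.linearCombination_single, one_smul]
      rw [inner_rep]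
      refine (h1.trans_le ?_).trans hN
      exact one_div_le_one_div_of_le (by positivity) (by exact_mod_cast Nat.succ_le_succ hi.2)
    intro a b
    rw [hone]; rfl
  · intro s f f' h a b
    rw [hB, hB]
    congr 2; ext i
    refine Finset.sum_congr rfl fun l _ => ?_
    simp only [T, orbitMap_shift]
    exact weighted_leftRegular s h _ _

/-- `H` is spanned topologically by pairwise orthogonal cyclic subspaces. -/
theorem exists_orthogonal_cyclic [CompleteSpace H] (π : OrthRep G H) :
    ∃ W : Set H, (∀ w ∈ W, ∀ w' ∈ W, w ≠ w' → ∀ g, inner ℝ (π g w) w' = 0) ∧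
      (Submodule.span ℝ {x | ∃ w ∈ W, ∃ g, π g w = x}).topologicalClosure = ⊤ := by
  obtain ⟨W, hW⟩ := zorn_subset
    {W : Set H | ∀ w ∈ W, ∀ w' ∈ W, w ≠ w' → ∀ g, inner ℝ (π g w) w' = 0} (by
      refine fun c hc hchain => ⟨⋃₀ c, ?_, fun s hs => Set.subset_sUnion_of_mem hs⟩
      rintro w ⟨s, hs, hw⟩ w' ⟨t, ht, hw'⟩ hne g
      rcases hchain.total hs ht with h | h
      · exact hc ht w (h hw) w' hw' hne g
      · exact hc hs w hw w' (h hw') hne g)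
  refine ⟨W, hW.prop, ?_⟩
  rw [Submodule.topologicalClosure_eq_top_iff, Submodule.eq_bot_iff]
  intro v hv
  rw [Submodule.mem_orthogonal] at hv
  have hv1 : ∀ w ∈ W, ∀ g, inner ℝ (π g w) v = 0 :=
    fun w hw g => hv _ (Submodule.subset_span ⟨w, hw, g, rfl⟩)
  have hv2 : ∀ w ∈ W, ∀ g, inner ℝ (π g v) w = 0 := fun w hw g => by
    have : inner ℝ (π g v) w = inner ℝ v (π g⁻¹ w) := by
      rw [← LinearIsometryEquiv.inner_map_map (π g) v, ← rep_mul_apply, mul_inv_cancel,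
        rep_one_apply]
    rw [this, real_inner_comm, hv1 w hw]
  -- A vector orthogonal to every cyclic subspace could be adjoined to `W`; by maximality it already
  -- lies there, so it is orthogonal to itself.
  have hmem : v ∈ W := by
    refine hW.le_of_ge (y := insert v W) ?_ (Set.subset_insert v W) (Set.mem_insert v W)
    rintro w (rfl | hw) w' (rfl | hw') hne g
    · exact absurd rfl hne
    · exact hv2 w' hw' g
    · exact hv1 w hw g
    · exact hW.prop w hw w' hw' hne g
  have h := hv1 v hmem 1
  rw [rep_one_apply] at h
  exact inner_self_eq_zero.1 h

/-- A weakly-`ℓ²` representation carries an equivariant form with dense range. -/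
theorem exists_equivariantForm [CompleteSpace H] {π : OrthRep G H} (hπ : IsWeaklyL2 π) :
    ∃ (W : Set H) (ι : (W →₀ G →₀ ℝ) →ₗ[ℝ] H) (sh : G → (W →₀ G →₀ ℝ) →ₗ[ℝ] (W →₀ G →₀ ℝ))
      (B : lp (fun _ : G => ℝ) ∞ → (W →₀ G →₀ ℝ) →ₗ[ℝ] (W →₀ G →₀ ℝ) →ₗ[ℝ] ℝ),
      IsEquivariantForm (V := W →₀ G →₀ ℝ) π ι sh B ∧ DenseRange ι := by
  obtain ⟨W, hW, hdense⟩ := exists_orthogonal_cyclic π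
  choose β hβ using fun w : W => exists_equivariantForm_cyclic hπ (w : H)
  let ι : (W →₀ G →₀ ℝ) →ₗ[ℝ] H := Finsupp.lsum ℝ fun w : W => orbitMap π (w : H)
  let sh : G → (W →₀ G →₀ ℝ) →ₗ[ℝ] (W →₀ G →₀ ℝ) := fun s => Finsupp.mapRange.linearMap (shift s)
  -- The forms for different `w` come from unrelated approximations, so they are combined
  -- block-diagonally. Orthogonality of the cyclic subspaces makes `B 1` the inner product
  -- nevertheless.
  let B : lp (fun _ : G => ℝ) ∞ → (W →₀ G →₀ ℝ) →ₗ[ℝ] (W →₀ G →₀ ℝ) →ₗ[ℝ] ℝ := fun f =>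
    Finsupp.lsum ℝ fun w : W => (β w f).compl₂ (Finsupp.lapply w)
  have hB : ∀ f a b, B f a b = ∑ w ∈ a.support, β w f (a w) (b w) := fun f a b => by
    simp [B, Finsupp.lsum_apply, Finsupp.sum]
  refine ⟨W, ι, sh, B, ⟨?_, ?_, ?_, ?_, ?_, ?_, ?_⟩, ?_⟩
  · intro s a
    have : ι ∘ₗ sh s = (π s).toLinearEquiv.toLinearMap ∘ₗ ι := by
      refine Finsupp.lhom_ext fun w b => ?_
      simp [ι, sh, orbitMap_shift]
    exact LinearMap.congr_fun this a
  · intro f f' a b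
    simp only [hB, (hβ _).add, Finset.sum_add_distrib]
  · intro c f a b
    simp only [hB, (hβ _).smul, Finset.mul_sum]
  · classical
    intro f a b
    have hsup : ∀ a b : W →₀ G →₀ ℝ,
        B f a b = ∑ w ∈ a.support ∪ b.support, β w f (a w) (b w) := fun a b => by
      rw [hB]
      refine Finset.sum_subset Finset.subset_union_left fun w _ hw => ?_
      rw [Finsupp.notMem_support_iff.1 hw, map_zero, LinearMap.zero_apply]
    rw [hsup, hsup, Finset.union_comm]
    exact Finset.sum_congr rfl fun w _ => (hβ w).symm _ _ _
  · intro f hf a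
    rw [hB]
    exact Finset.sum_nonneg fun w _ => (hβ w).nonneg f hf _
  · have horth : ∀ w w' : W, w ≠ w' → ∀ a b, inner ℝ (orbitMap π (w : H) a)
        (orbitMap π (w' : H) b) = 0 := by
      intro w w' hne a b
      have : (innerₗ H).compl₁₂ (orbitMap π (w : H)) (orbitMap π (w' : H)) = 0 := by
        ext g k
        simp only [LinearMap.coe_comp, Function.comp_apply, Finsupp.lsingle_apply,
          LinearMap.compl₁₂_apply, innerₗ_apply_apply, orbitMap,
          Finsupp.linearCombination_single, one_smul, LinearMap.zero_apply]
        have := hW w w.2 w' w'.2 (fun h => hne (Subtype.ext h)) (k⁻¹ * g)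
        rw [← LinearIsometryEquiv.inner_map_map (π k), ← rep_mul_apply,
          mul_inv_cancel_left] at this
        exact this
      exact LinearMap.congr_fun₂ this a b
    have hone : B 1 = (innerₗ H).compl₁₂ ι ι := by
      refine Finsupp.lhom_ext fun w a => ?_
      refine Finsupp.lhom_ext fun w' b => ?_
      by_cases hww : w = w'
      · subst hww
        simp [B, ι, (hβ w).one]
      · simp [B, ι, horth w w' hww, Finsupp.single_eq_of_ne hww]
    intro a b
    rw [hone]; rfl
  · classical
    intro s f f' h a b
    rw [hB, hB]
    have hsub : (sh s a).support ⊆ a.support := Finsupp.support_mapRange (hf := map_zero (shift s))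
    rw [Finset.sum_subset hsub fun w _ hw => by
      rw [Finsupp.notMem_support_iff.1 hw, map_zero, LinearMap.zero_apply]]
    refine Finset.sum_congr rfl fun w _ => ?_
    exact (hβ w).equivariant s f f' h _ _
  · have hrange : Submodule.span ℝ {x | ∃ w ∈ W, ∃ g, π g w = x} ≤ LinearMap.range ι := by
      rw [Submodule.span_le]
      rintro _ ⟨w, hw, g, rfl⟩
      exact ⟨Finsupp.single ⟨w, hw⟩ (Finsupp.single g 1), by simp [ι, orbitMap]⟩
    rw [DenseRange, dense_iff_closure_eq, Set.eq_univ_iff_forall]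
    intro x
    have hx : x ∈ (Submodule.span ℝ {x | ∃ w ∈ W, ∃ g, π g w = x}).topologicalClosure := by
      rw [hdense]; trivial
    exact closure_mono hrange hx

namespace IsEquivariantForm

variable {π : OrthRep G H} {V : Type w} [AddCommGroup V] [Module ℝ V] {ι : V →ₗ[ℝ] H}
  {sh : G → V →ₗ[ℝ] V} {B : lp (fun _ : G => ℝ) ∞ → V →ₗ[ℝ] V →ₗ[ℝ] ℝ}

/-- Positivity is applied to `‖f‖ • 1 + f` and `‖f‖ • 1 - f`. -/
theorem abs_self_le (hB : IsEquivariantForm π ι sh B) (f : lp (fun _ : G => ℝ) ∞) (a : V) :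
    |B f a a| ≤ ‖f‖ * ‖ι a‖ ^ 2 := by
  have h1 := hB.nonneg (‖f‖ • 1 + f) (fun x => by
    have := (abs_le.1 (abs_le_norm_linf f x)).1
    change 0 ≤ ‖f‖ * 1 + f x
    linarith) a
  have h2 := hB.nonneg (‖f‖ • 1 + (-1 : ℝ) • f) (fun x => by
    have := (abs_le.1 (abs_le_norm_linf f x)).2
    change 0 ≤ ‖f‖ * 1 + (-1) * f x
    linarith) a
  rw [hB.add, hB.smul, hB.one, real_inner_self_eq_norm_sq] at h1 h2
  rw [hB.smul] at h2
  exact abs_le.2 ⟨by linarith, by linarith⟩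

/-- Polarization of `abs_self_le`. -/
theorem abs_sub_le (hB : IsEquivariantForm π ι sh B) (f : lp (fun _ : G => ℝ) ∞) (a b : V) :
    |B f a a - B f b b| ≤ ‖f‖ * ‖ι a - ι b‖ * (‖ι a‖ + ‖ι b‖) := by
  have key : ∀ u v : V, |B f u v| ≤ ‖f‖ * (‖ι u‖ ^ 2 + ‖ι v‖ ^ 2) / 2 := by
    intro u v
    have h1 := abs_le.1 (hB.abs_self_le f (u + v))
    have h2 := abs_le.1 (hB.abs_self_le f (u - v))
    have h3 := congrArg (fun r => ‖f‖ * r) (parallelogram_law_with_norm ℝ (ι u) (ι v))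
    have e1 : B f (u + v) (u + v) - B f (u - v) (u - v) = 4 * B f u v := by
      simp only [map_add, map_sub, LinearMap.add_apply, LinearMap.sub_apply, hB.symm f v u]
      ring
    rw [map_add, sq] at h1
    rw [map_sub, sq] at h2
    simp only [mul_add] at h3
    rw [abs_le]
    constructor <;> nlinarith
  have cs : ∀ u v : V, |B f u v| ≤ ‖f‖ * (‖ι u‖ * ‖ι v‖) := by
    intro u v
    have hlim : Tendsto (fun δ : ℝ => ‖f‖ * ((‖ι u‖ + δ) * (‖ι v‖ + δ))) (𝓝[>] 0)
        (𝓝 (‖f‖ * (‖ι u‖ * ‖ι v‖))) := by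
      have : Continuous fun δ : ℝ => ‖f‖ * ((‖ι u‖ + δ) * (‖ι v‖ + δ)) := by fun_prop
      simpa using (this.tendsto 0).mono_left nhdsWithin_le_nhds
    refine ge_of_tendsto hlim ?_
    filter_upwards [self_mem_nhdsWithin] with δ hδ
    have hδ : 0 < δ := hδ
    -- Scaling `u` by `q` and `v` by `p` gives both norm at most `q * p`, which turns `key` into
    -- Cauchy–Schwarz. The `δ` keeps the scalars positive when a norm vanishes.
    set p := ‖ι u‖ + δ with hp
    set q := ‖ι v‖ + δ with hq
    have hp0 : 0 < p := by positivity
    have hq0 : 0 < q := by positivity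
    have h := key (q • u) (p • v)
    simp only [map_smul, LinearMap.smul_apply, smul_eq_mul, norm_smul, Real.norm_of_nonneg hp0.le,
      Real.norm_of_nonneg hq0.le, abs_mul, abs_of_pos hp0, abs_of_pos hq0] at h
    have hu : (q * ‖ι u‖) ^ 2 ≤ (q * p) ^ 2 := by gcongr; linarith
    have hv : (p * ‖ι v‖) ^ 2 ≤ (q * p) ^ 2 := by rw [mul_comm q p]; gcongr; linarith
    have hf := mul_le_mul_of_nonneg_left (add_le_add hu hv) (norm_nonneg f)
    refine le_of_mul_le_mul_left ?_ (mul_pos hq0 hp0)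
    nlinarith
  have e : B f a a - B f b b = B f (a - b) (a + b) := by
    simp only [map_add, map_sub, LinearMap.sub_apply, hB.symm f b a]; ring
  rw [e, mul_assoc]
  refine (cs _ _).trans (mul_le_mul_of_nonneg_left ?_ (norm_nonneg _))
  rw [map_sub, map_add]
  exact mul_le_mul_of_nonneg_left (norm_add_le _ _) (norm_nonneg _)

end IsEquivariantForm

end Forms

/-! ### Quasi-cocycles -/

section QuasiCocycle

variable {G : Type u} [Group G] {H : Type v} [NormedAddCommGroup H] [InnerProductSpace ℝ H]
  {π : OrthRep G H} {q : G → H}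

theorem norm_inv_of_antisymm (hq : ∀ g, q g = -π g (q g⁻¹)) (g : G) : ‖q g⁻¹‖ = ‖q g‖ := by
  rw [hq g, norm_neg, LinearIsometryEquiv.norm_map]

/-- The behaviour of an anti-symmetric quasi-cocycle under conjugation. -/
theorem norm_conj_le {C : ℝ} (hC : ∀ g h : G, ‖q (g * h) - q g - π g (q h)‖ ≤ C)
    (hq : ∀ g, q g = -π g (q g⁻¹)) (g h : G) :
    ‖q (g * h * g⁻¹) - π g (q h) - (q g - π (g * h * g⁻¹) (q g))‖ ≤ 2 * C := by
  -- Anti-symmetry trades `q g` for `q g⁻¹`, so that two uses of the quasi-cocycle bound suffice.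
  have e : π (g * h * g⁻¹) (q g) = -π (g * h) (q g⁻¹) := by
    conv_lhs => rw [hq g]
    rw [map_neg, ← rep_mul_apply, inv_mul_cancel_right]
  have h1 := hC (g * h) g⁻¹
  have h2 := hC g h
  have h3 := norm_add_le (q (g * h * g⁻¹) - q (g * h) - π (g * h) (q g⁻¹))
    (q (g * h) - q g - π g (q h))
  rw [e]
  have e2 : q (g * h * g⁻¹) - π g (q h) - (q g - -π (g * h) (q g⁻¹))
      = q (g * h * g⁻¹) - q (g * h) - π (g * h) (q g⁻¹) + (q (g * h) - q g - π g (q h)) := by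
    abel
  rw [e2]
  linarith

/-- A mixing representation moves a long vector by a short distance only finitely often. -/
theorem norm_le_of_infinite (hmix : IsMixing π) {v : H} {c : ℝ}
    (h : {k | ‖v - π k v‖ ≤ c}.Infinite) : ‖v‖ ≤ c := by
  obtain ⟨k₀, hk₀⟩ := h.nonempty
  have hc : 0 ≤ c := (norm_nonneg _).trans hk₀
  by_contra! hlt
  -- Once `⟨π k v, v⟩ < ‖v‖ ^ 2 / 2`, the squared displacement `2 * ‖v‖ ^ 2 - 2 * ⟨π k v, v⟩`
  -- exceeds `‖v‖ ^ 2`.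
  have hpos : 0 < ‖v‖ ^ 2 / 2 := by have := hc.trans_lt hlt; positivity
  have hev := (hmix v v).eventually (gt_mem_nhds hpos)
  obtain ⟨k, hk, hk'⟩ := (h.frequently_cofinite.and_eventually hev).exists
  have e := norm_sub_sq_real v (π k v)
  rw [LinearIsometryEquiv.norm_map, real_inner_comm] at e
  have h1 : ‖v - π k v‖ ^ 2 ≤ c ^ 2 := pow_le_pow_left₀ (norm_nonneg _) hk 2
  have h2 : c ^ 2 < ‖v‖ ^ 2 := pow_lt_pow_left₀ hlt hc two_ne_zero
  linarith

/-- An anti-symmetric quasi-cocycle of a mixing representation that is bounded on an infinite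
normal subgroup is bounded. -/
theorem bounded_of_bounded_on_normal (hmix : IsMixing π) (hqc : IsQuasiCocycle π q)
    (hq : ∀ g, q g = -π g (q g⁻¹)) (S : Subgroup G) [S.Normal] [Infinite S]
    (hS : ∃ D : ℝ, ∀ s ∈ S, ‖q s‖ ≤ D) : ∃ D : ℝ, ∀ g, ‖q g‖ ≤ D := by
  obtain ⟨C, hC⟩ := hqc
  obtain ⟨D, hD⟩ := hS
  have hinf : (S : Set G).Infinite := Set.infinite_coe_iff.1 ‹Infinite S›
  -- For every `k` in `S` both `k` and `g⁻¹ * k * g` lie in `S`, so the conjugation formula shows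
  -- that `π k` displaces `q g` by at most this constant.
  refine ⟨2 * C + 2 * D, fun g => norm_le_of_infinite hmix (hinf.mono fun k hk => ?_)⟩
  have hk' : g⁻¹ * k * g ∈ S := by
    simpa using Subgroup.Normal.conj_mem ‹S.Normal› k hk g⁻¹
  have h1 := norm_conj_le hC hq g (g⁻¹ * k * g)
  have e : g * (g⁻¹ * k * g) * g⁻¹ = k := by group
  rw [e, norm_sub_rev] at h1
  have h2 := norm_le_insert' (q g - π k (q g)) (q k - π g (q (g⁻¹ * k * g)))
  have h3 := norm_sub_le (q k) (π g (q (g⁻¹ * k * g)))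
  rw [LinearIsometryEquiv.norm_map] at h3
  have h4 := hD k hk
  have h5 := hD _ hk'
  change ‖q g - π k (q g)‖ ≤ _
  linarith

/-- A conjugation invariant mean without atoms is not concentrated on the sublevel sets of an
unbounded quasi-cocycle. -/
theorem isNull_sublevel (hmix : IsMixing π) (hqc : IsQuasiCocycle π q)
    (hq : ∀ g, q g = -π g (q g⁻¹)) (S : Subgroup G) (hS : ¬ ∃ D : ℝ, ∀ s ∈ S, ‖q s‖ ≤ D)
    {m : lp (fun _ : G => ℝ) ∞ →ₗ[ℝ] ℝ} (hm : IsMean m)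
    (hinv : ∀ s ∈ S, InvariantUnder m (fun x => s * x * s⁻¹)) (hdiff : ∀ x, IsNull m {x})
    (R : ℝ) : IsNull m {h | ‖q h‖ ≤ R} := by
  obtain ⟨C, hC⟩ := hqc
  have hC0 : 0 ≤ C := (norm_nonneg _).trans (hC 1 1)
  set K := 2 * C + 2 * |R| with hK
  have hK0 : 0 ≤ K := by positivity
  push Not at hS
  -- Jumps larger than `C + K` force `‖q (γ j * (γ i)⁻¹)‖ > K` for `i < j`. A common point of two
  -- conjugated sublevel sets makes `π` displace this vector by at most `K`, which mixing permits
  -- only finitely often.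
  choose nxt hnS hnxt using fun r : ℝ => hS (r + C + K)
  let γ : ℕ → G := fun n => Nat.rec (nxt 0) (fun _ g => nxt ‖q g‖) n
  have hγS : ∀ n, γ n ∈ S := by
    intro n
    cases n with
    | zero => exact hnS 0
    | succ n => exact hnS _
  have hstep : ∀ n, ‖q (γ n)‖ + C + K < ‖q (γ (n + 1))‖ := fun n => hnxt ‖q (γ n)‖
  have hmono : Monotone fun n => ‖q (γ n)‖ := monotone_nat_of_le_succ fun n => by
    linarith [hstep n]
  have hgap : ∀ i j, i < j → ‖q (γ i)‖ + C + K < ‖q (γ j)‖ := fun i j hij =>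
    (hstep i).trans_le (hmono hij)
  have hlarge : ∀ i j, i < j → K < ‖q (γ j * (γ i)⁻¹)‖ := by
    intro i j hij
    have h1 := hC (γ j) (γ i)⁻¹
    rw [sub_sub] at h1
    have h2 := norm_le_insert' (q (γ j) + π (γ j) (q (γ i)⁻¹)) (q (γ j * (γ i)⁻¹))
    rw [norm_sub_rev] at h2
    have h3 := norm_sub_le_norm_add (q (γ j)) (π (γ j) (q (γ i)⁻¹))
    rw [LinearIsometryEquiv.norm_map, norm_inv_of_antisymm hq] at h3
    linarith [hgap i j hij]
  refine isNull_of_almost_disjoint hm (fun n => (fun x => γ n * x * (γ n)⁻¹) ⁻¹' {h | ‖q h‖ ≤ R})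
    (fun n => mean_comp (hinv _ (hγS n)) (IsBdd.indicator {h | ‖q h‖ ≤ R})) fun i j hij =>
    isNull_of_finite hm hdiff ?_
  set g := γ j * (γ i)⁻¹ with hg
  have hfin : {k | ‖q g - π k (q g)‖ ≤ K}.Finite := by
    by_contra hinf
    exact absurd (norm_le_of_infinite hmix hinf) (not_le.2 (hlarge i j hij))
  refine (hfin.preimage (f := fun x => γ j * x * (γ j)⁻¹)
    (fun x _ y _ hxy => by simpa using hxy)).subset ?_
  rintro x ⟨hx, hy⟩
  simp only [Set.mem_preimage, Set.mem_ofPred_eq] at hx hy ⊢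
  have h1 := norm_conj_le hC hq g (γ i * x * (γ i)⁻¹)
  have e : g * (γ i * x * (γ i)⁻¹) * g⁻¹ = γ j * x * (γ j)⁻¹ := by rw [hg]; group
  rw [e, norm_sub_rev] at h1
  have h2 := norm_le_insert' (q g - π (γ j * x * (γ j)⁻¹) (q g))
    (q (γ j * x * (γ j)⁻¹) - π g (q (γ i * x * (γ i)⁻¹)))
  have h3 := norm_sub_le (q (γ j * x * (γ j)⁻¹)) (π g (q (γ i * x * (γ i)⁻¹)))
  rw [LinearIsometryEquiv.norm_map] at h3
  linarith [le_abs_self R]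

/-- Comparison of normalized quadratic quantities. -/
theorem abs_div_sub_div_le {x y a b c K ε : ℝ} (ha : 0 ≤ a) (hc : 0 ≤ c) (hK : 0 ≤ K)
    (hε : 0 < ε) (hab : |a - b| ≤ K) (hxy : |x - y| ≤ c * K * (a + b)) (hy : |y| ≤ c * b ^ 2)
    (hlarge : 2 * K + 12 * c * K / ε + 1 ≤ a) : |x / a ^ 2 - y / b ^ 2| ≤ ε := by
  have hq : 0 ≤ 12 * c * K / ε := by positivity
  have ha1 : 0 < a := by linarith
  obtain ⟨h1, h2⟩ := abs_le.1 hab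
  have hb1 : 0 < b := by linarith
  have hb2 : b ≤ 2 * a := by linarith
  have hca : 12 * c * K ≤ ε * a := by
    have : 12 * c * K / ε ≤ a := by linarith
    rwa [div_le_iff₀ hε, mul_comm a] at this
  -- Changing the numerator and changing the denominator each cost at most `c * K * (a + b)`, and `b
  -- ≤ 2 * a`; the lower bound on `a` absorbs the total `6 * c * K * a`.
  have e : x / a ^ 2 - y / b ^ 2 = ((x - y) + (y / b ^ 2) * (b ^ 2 - a ^ 2)) / a ^ 2 := by
    field_simp; ring
  have hyb : |y / b ^ 2| ≤ c := by
    rw [abs_div, abs_of_pos (pow_pos hb1 2), div_le_iff₀ (pow_pos hb1 2)]; exact hy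
  have hba : |b ^ 2 - a ^ 2| ≤ K * (a + b) := by
    rw [show b ^ 2 - a ^ 2 = (b - a) * (a + b) by ring, abs_mul, abs_of_pos (add_pos ha1 hb1),
      abs_sub_comm]
    exact mul_le_mul_of_nonneg_right hab (add_pos ha1 hb1).le
  rw [e, abs_div, abs_of_pos (pow_pos ha1 2), div_le_iff₀ (pow_pos ha1 2)]
  calc |x - y + y / b ^ 2 * (b ^ 2 - a ^ 2)|
      ≤ |x - y| + |y / b ^ 2| * |b ^ 2 - a ^ 2| := by
        rw [← abs_mul]; exact abs_add_le _ _
    _ ≤ c * K * (a + b) + c * (K * (a + b)) :=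
        add_le_add hxy (mul_le_mul hyb hba (abs_nonneg _) hc)
    _ = 2 * (c * K) * (a + b) := by ring
    _ ≤ 2 * (c * K) * (3 * a) := by
        refine mul_le_mul_of_nonneg_left (by linarith) (by positivity)
    _ ≤ ε * a ^ 2 := by nlinarith [mul_nonneg (mul_nonneg hc hK) ha]

/-- A conjugation invariant mean for which an anti-symmetric quasi-cocycle of a weakly-`ℓ²`
representation is almost everywhere large forces amenability. -/
theorem isAmenable_of_isNull_sublevel [CompleteSpace H] (hπ : IsWeaklyL2 π)
    (hqc : IsQuasiCocycle π q) (hq : ∀ g, q g = -π g (q g⁻¹)) (S : Subgroup G)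
    {m : lp (fun _ : G => ℝ) ∞ →ₗ[ℝ] ℝ} (hm : IsMean m)
    (hinv : ∀ s ∈ S, InvariantUnder m (fun x => s * x * s⁻¹))
    (hnull : ∀ R, IsNull m {h | ‖q h‖ ≤ R}) : IsAmenable S := by
  obtain ⟨C, hC⟩ := hqc
  have hC0 : 0 ≤ C := (norm_nonneg _).trans (hC 1 1)
  obtain ⟨W, ι, sh, B, hB, hdense⟩ := exists_equivariantForm hπ
  -- The forms live only over the dense range of `ι`, so `q h` is replaced by a lift at distance at
  -- most `1`. This accounts for the `+ 2` in `K` and for the shift of thresholds by `1`.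
  have happ : ∀ h, ∃ a, ‖ι a - q h‖ ≤ 1 := fun h => by
    obtain ⟨a, ha⟩ := hdense.exists_dist_lt (q h) one_pos
    exact ⟨a, by rw [← dist_eq_norm, dist_comm]; exact ha.le⟩
  choose a ha using happ
  -- Where `ι (a h) = 0` the quotient is `0` and `μ h` is not a mean, but this happens only on the
  -- null set `‖q h‖ ≤ 1`.
  let μ : G → lp (fun _ : G => ℝ) ∞ →ₗ[ℝ] ℝ := fun h =>
    { toFun := fun f => B f (a h) (a h) / ‖ι (a h)‖ ^ 2
      map_add' := fun f f' => by rw [hB.add, add_div]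
      map_smul' := fun c f => by rw [hB.smul, mul_div_assoc]; rfl }
  have hμa : ∀ h f, μ h f = B f (a h) (a h) / ‖ι (a h)‖ ^ 2 := fun _ _ => rfl
  have hμ : ∀ f, IsBdd (fun h => μ h f) := fun f => ⟨‖f‖, fun h => by
    beta_reduce
    rw [hμa, abs_div, abs_of_nonneg (sq_nonneg ‖ι (a h)‖)]
    exact div_le_of_le_mul₀ (sq_nonneg _) (norm_nonneg _) (hB.abs_self_le f _)⟩
  have hsmall : ∀ R h, ‖ι (a h)‖ ≤ R → ‖q h‖ ≤ R + 1 := fun R h hR => by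
    have := norm_le_insert (ι (a h)) (q h)
    linarith [ha h]
  refine isAmenable_subgroup_of_mean S (m := mixMean m μ hμ) ⟨fun f hf => ?_, ?_⟩
    fun s hs f f' hff' => ?_
  · exact mean_nonneg hm (hμ f) fun h => div_nonneg (hB.nonneg f hf _) (sq_nonneg _)
  · rw [← mean_const hm 1]
    refine mean_eq_of_null hm (hμ 1) (.const 1) fun ε hε => ⟨_, hnull 1, fun h hh => ?_⟩
    have hne : ‖ι (a h)‖ ≠ 0 := fun h0 => hh (by simpa using hsmall 0 h h0.le)
    rw [hμa, hB.one, real_inner_self_eq_norm_sq, div_self (pow_ne_zero 2 hne), sub_self, abs_zero]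
    exact hε.le
  · refine Eq.trans ?_ (mean_comp (hinv s hs) (hμ f))
    change m (toLinf fun h => μ h f') = _
    refine mean_eq_of_null hm (hμ f') ((hμ f).comp _) fun ε hε => ?_
    set K := 2 * C + 2 * ‖q s‖ + 2
    refine ⟨_, hnull (2 * K + 12 * ‖f'‖ * K / ε + 1 + 1), fun h hh => ?_⟩
    have hlarge : 2 * K + 12 * ‖f'‖ * K / ε + 1 ≤ ‖ι (a h)‖ := by
      by_contra! hlt
      exact hh (hsmall _ h hlt.le)
    set k := s * h * s⁻¹ with hk
    -- Equivariance pulls the state at `k` back by `s⁻¹`, so the same form `B f'` is compared at two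
    -- vectors within `K` of each other.
    have hBk : B f (a k) (a k) = B f' (sh s⁻¹ (a k)) (sh s⁻¹ (a k)) :=
      (hB.equivariant s⁻¹ f f' (fun x => by rw [hff']; simp) _ _).symm
    have hιk : ‖ι (sh s⁻¹ (a k))‖ = ‖ι (a k)‖ := by
      rw [hB.lift, LinearIsometryEquiv.norm_map]
    have hdist : ‖ι (a h) - ι (sh s⁻¹ (a k))‖ ≤ K := by
      have e1 : ‖ι (a h) - ι (sh s⁻¹ (a k))‖ = ‖π s (ι (a h)) - ι (a k)‖ := by
        rw [← LinearIsometryEquiv.norm_map (π s), map_sub, hB.lift, ← rep_mul_apply,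
          mul_inv_cancel, rep_one_apply]
      have h1 := norm_conj_le hC hq s h
      rw [← hk] at h1
      have h2 : ‖π s (ι (a h)) - π s (q h)‖ ≤ 1 := by
        rw [← map_sub, LinearIsometryEquiv.norm_map]; exact ha h
      have h3 := ha k
      have h4 := norm_sub_le (q s) (π k (q s))
      rw [LinearIsometryEquiv.norm_map] at h4
      have e2 : π s (ι (a h)) - ι (a k) = (π s (ι (a h)) - π s (q h)) - (ι (a k) - q k)
          - (q k - π s (q h) - (q s - π k (q s))) - (q s - π k (q s)) := by abel
      rw [e1, e2]
      have n1 := norm_sub_le ((π s (ι (a h)) - π s (q h)) - (ι (a k) - q k)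
          - (q k - π s (q h) - (q s - π k (q s)))) (q s - π k (q s))
      have n2 := norm_sub_le ((π s (ι (a h)) - π s (q h)) - (ι (a k) - q k))
          (q k - π s (q h) - (q s - π k (q s)))
      have n3 := norm_sub_le (π s (ι (a h)) - π s (q h)) (ι (a k) - q k)
      simp only [K]
      linarith
    have hK0 : 0 ≤ K := (norm_nonneg _).trans hdist
    change |μ h f' - μ k f| ≤ ε
    rw [hμa, hμa, hBk, ← hιk]
    refine abs_div_sub_div_le (norm_nonneg _) (norm_nonneg f') hK0 hε
      ((abs_norm_sub_norm_le _ _).trans hdist) ((hB.abs_sub_le f' _ _).trans ?_)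
      (hB.abs_self_le f' _) hlarge
    gcongr

end QuasiCocycle

/-- In a group in `NC₁`, a normal subgroup whose conjugation action preserves a mean without atoms
is amenable. -/
theorem IsNC1.isAmenable_of_mean {G : Type u} [Group G] (hG : IsNC1 G) (S : Subgroup G) [S.Normal]
    {m : lp (fun _ : G => ℝ) ∞ →ₗ[ℝ] ℝ} (hm : IsMean m)
    (hinv : ∀ s ∈ S, InvariantUnder m (fun x => s * x * s⁻¹)) (hdiff : ∀ x, IsNull m {x}) :
    IsAmenable S := by
  obtain ⟨-, H, _, _, _, π, hπ, hmix, q, hqc, hq, hunb⟩ := hG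
  -- Mixing says nothing about a finite `S`, which is amenable anyway.
  rcases finite_or_infinite S with hS | hS
  · exact isAmenable_of_finite S
  · exact isAmenable_of_isNull_sublevel hπ hqc hq S hm hinv
      (isNull_sublevel hmix hqc hq S
        (fun h => hunb (bounded_of_bounded_on_normal hmix hqc hq S h)) hm hinv hdiff)

/-! ### Finite conjugation orbits -/

section Orbits

variable {G : Type u} [Group G]

theorem mem_conjOrbit_self (S : Subgroup G) (g : G) : g ∈ conjOrbit S g := ⟨1, by simp⟩

theorem conjOrbit_eq_of_mem {S : Subgroup G} {g x : G} (h : x ∈ conjOrbit S g) :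
    conjOrbit S x = conjOrbit S g := by
  obtain ⟨s, rfl⟩ := h
  ext y
  constructor
  · rintro ⟨t, rfl⟩
    exact ⟨t * s, by simp [mul_assoc]⟩
  · rintro ⟨t, rfl⟩
    exact ⟨t * s⁻¹, by simp [mul_assoc]⟩

theorem conj_mem_conjOrbit {S : Subgroup G} {g x s : G} (hs : s ∈ S) (h : x ∈ conjOrbit S g) :
    s * x * s⁻¹ ∈ conjOrbit S g := by
  obtain ⟨t, rfl⟩ := h
  exact ⟨⟨s, hs⟩ * t, by simp [mul_assoc]⟩

theorem mem_conjugatesOf_iff {g x : G} : x ∈ conjugatesOf g ↔ IsConj g x := Iff.rfl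

theorem conjOrbit_top (g : G) : conjOrbit ⊤ g = conjugatesOf g := by
  ext x
  rw [mem_conjugatesOf_iff, isConj_iff]
  exact ⟨fun ⟨s, h⟩ => ⟨s, h⟩, fun ⟨s, h⟩ => ⟨⟨s, trivial⟩, h⟩⟩

/-- If a subgroup has infinitely many finite conjugation orbits, there is a mean without atoms that
is invariant under conjugation by the subgroup. -/
theorem exists_mean_of_infinite_finite_orbits (S : Subgroup G)
    (h : {O : Set G | O.Finite ∧ ∃ g : G, O = conjOrbit S g}.Infinite) :
    ∃ m : lp (fun _ : G => ℝ) ∞ →ₗ[ℝ] ℝ, IsMean m ∧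
      (∀ s ∈ S, InvariantUnder m (fun x => s * x * s⁻¹)) ∧ ∀ x, IsNull m {x} := by
  have := h.to_subtype
  set I := {O : Set G | O.Finite ∧ ∃ g : G, O = conjOrbit S g}
  -- Orbits are disjoint, so a given point is charged by at most one orbit average, and the cofinite
  -- limit ignores that orbit.
  obtain ⟨n, hn, hlim⟩ := exists_mean_of_filter (cofinite : Filter I)
  let μ : I → lp (fun _ : G => ℝ) ∞ →ₗ[ℝ] ℝ := fun O => finsetAverage O.2.1.toFinset
  have hμm : ∀ O, IsMean (μ O) := fun O => isMean_finsetAverage <| by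
    obtain ⟨O, hO, g, rfl⟩ := O
    exact ⟨g, by simpa using mem_conjOrbit_self S g⟩
  have hμ : ∀ f, IsBdd (fun O => μ O f) := fun f => ⟨‖f‖, fun O => (hμm O).abs_le_norm f⟩
  refine ⟨mixMean n μ hμ, ⟨fun f hf => mean_nonneg hn (hμ f) fun O => (hμm O).1 f hf, ?_⟩,
    fun s hs f f' hff' => ?_, fun x => ?_⟩
  · refine Eq.trans ?_ (mean_const hn 1)
    change n (toLinf fun O => μ O 1) = _
    simp only [fun O => (hμm O).2]
  · change n (toLinf fun O => μ O f') = n (toLinf fun O => μ O f)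
    congr 2
    ext O
    simp only [μ, finsetAverage_apply, hff']
    congr 1
    obtain ⟨O, hO, g, rfl⟩ := O
    refine Finset.sum_bij' (fun x _ => s * x * s⁻¹) (fun x _ => s⁻¹ * x * s) ?_ ?_ ?_ ?_ ?_
    · intro x hx
      simp only [Set.Finite.mem_toFinset] at hx ⊢
      exact conj_mem_conjOrbit hs hx
    · intro x hx
      simp only [Set.Finite.mem_toFinset] at hx ⊢
      simpa using conj_mem_conjOrbit (S.inv_mem hs) hx
    · intro x _; group
    · intro x _; group
    · intro x _; rfl
  · refine hlim _ (hμ _) 0 (tendsto_const_nhds.congr' ?_)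
    have hsub : {O : I | x ∈ (O : Set G)}.Subsingleton := by
      rintro ⟨O, hO, g, rfl⟩ hx ⟨O', hO', g', rfl⟩ hx'
      exact Subtype.ext ((conjOrbit_eq_of_mem hx).symm.trans (conjOrbit_eq_of_mem hx'))
    filter_upwards [hsub.finite.compl_mem_cofinite] with O hO
    have hO : x ∉ (O : Set G) := hO
    simp only [μ, finsetAverage_apply]
    rw [Finset.sum_eq_zero, mul_zero]
    intro y hy
    rw [toLinf_apply (.indicator _)]
    refine Set.indicator_of_notMem (fun hyx => hO ?_) _
    rw [Set.mem_singleton_iff] at hyx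
    rw [← hyx]
    simpa using hy

theorem IsNC1.finite_finite_orbits (hG : IsNC1 G) (S : Subgroup G) [S.Normal]
    (hS : ¬ IsAmenable S) : {O : Set G | O.Finite ∧ ∃ g : G, O = conjOrbit S g}.Finite := by
  by_contra hinf
  obtain ⟨m, hm, hinv, hdiff⟩ := exists_mean_of_infinite_finite_orbits S hinf
  exact hS (hG.isAmenable_of_mean S hm hinv hdiff)

theorem IsNC1.finite_finite_conjClasses (hG : IsNC1 G) :
    {C : ConjClasses G | C.carrier.Finite}.Finite := by
  have h := hG.finite_finite_orbits ⊤ fun ha => hG.1 (isAmenable_of_top ha)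
  refine Set.Finite.of_finite_image (f := ConjClasses.carrier) (h.subset ?_) ?_
  · rintro _ ⟨C, hC, rfl⟩
    refine ⟨hC, ?_⟩
    obtain ⟨g, rfl⟩ := ConjClasses.exists_rep C
    exact ⟨g, by rw [conjOrbit_top]; rfl⟩
  · intro C _ D _ hCD
    obtain ⟨g, rfl⟩ := ConjClasses.exists_rep C
    have hg : g ∈ D.carrier := hCD ▸ ConjClasses.mem_carrier_mk
    exact ConjClasses.mem_carrier_iff_mk_eq.1 hg

/-! ### The FC-centre -/

open scoped Pointwise in
/-- The FC-centre: the subgroup of elements with finite conjugacy class. -/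
def fcCenter (G : Type u) [Group G] : Subgroup G where
  carrier := {g | (conjugatesOf g).Finite}
  one_mem' := by
    refine (Set.finite_singleton (1 : G)).subset fun x hx => ?_
    rw [mem_conjugatesOf_iff, isConj_iff] at hx
    obtain ⟨c, hc⟩ := hx
    simpa using hc.symm
  mul_mem' := by
    intro g h hg hh
    refine (hg.mul hh).subset fun x hx => ?_
    rw [mem_conjugatesOf_iff, isConj_iff] at hx
    obtain ⟨c, rfl⟩ := hx
    exact ⟨c * g * c⁻¹, mem_conjugatesOf_iff.2 (isConj_iff.2 ⟨c, rfl⟩), c * h * c⁻¹,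
      mem_conjugatesOf_iff.2 (isConj_iff.2 ⟨c, rfl⟩), by simp [mul_assoc]⟩
  inv_mem' := by
    intro g hg
    refine hg.inv.subset fun x hx => ?_
    rw [mem_conjugatesOf_iff, isConj_iff] at hx
    obtain ⟨c, rfl⟩ := hx
    exact mem_conjugatesOf_iff.2 (isConj_iff.2 ⟨c, by simp [mul_assoc]⟩)

theorem mem_fcCenter {g : G} : g ∈ fcCenter G ↔ (conjugatesOf g).Finite := Iff.rfl

instance : (fcCenter G).Normal := ⟨fun g hg c => by
  rw [mem_fcCenter, ← (isConj_iff.2 ⟨c, rfl⟩ : IsConj g (c * g * c⁻¹)).conjugatesOf_eq]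
  exact hg⟩

/-- The FC-centre is the union of the finite conjugacy classes. -/
theorem finite_fcCenter (h : {C : ConjClasses G | C.carrier.Finite}.Finite) :
    Finite (fcCenter G) := by
  refine Set.Finite.subset (h.biUnion fun C hC => (hC : C.carrier.Finite)) fun g hg => ?_
  exact Set.mem_biUnion (x := ConjClasses.mk g) (by exact hg) ConjClasses.mem_carrier_mk

theorem IsNC1.infinite (hG : IsNC1 G) : Infinite G := by
  by_contra h
  rw [not_infinite_iff_finite] at h
  exact hG.1 (isAmenable_of_finite G)

/-- A finite class in the quotient has finite preimage, because the cosets are finite. The preimage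
contains the conjugacy class of any lift, so the lift already lies in the FC-centre. -/
theorem isICC_quotient_fcCenter [Infinite G] [Finite (fcCenter G)] : IsICC (G ⧸ fcCenter G) := by
  constructor
  · by_contra h
    rw [not_infinite_iff_finite] at h
    have : Finite G := Finite.of_equiv _ (fcCenter G).groupEquivQuotientProdSubgroup.symm
    exact not_finite G
  · intro x hx hfin
    obtain ⟨g, rfl⟩ := QuotientGroup.mk_surjective x
    refine hx ((QuotientGroup.eq_one_iff g).2 ?_)
    have hpre :
        (QuotientGroup.mk (s := fcCenter G) ⁻¹' conjugatesOf (g : G ⧸ fcCenter G)).Finite := by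
      refine Set.Finite.preimage' hfin fun b _ => ?_
      obtain ⟨k, rfl⟩ := QuotientGroup.mk_surjective b
      refine (Set.Finite.image (k * ·) (Set.toFinite (fcCenter G : Set G))).subset fun y hy => ?_
      exact ⟨k⁻¹ * y, QuotientGroup.eq.1 (Eq.symm hy), by simp⟩
    refine mem_fcCenter.2 (hpre.subset fun y hy => ?_)
    rw [mem_conjugatesOf_iff, isConj_iff] at hy
    obtain ⟨c, rfl⟩ := hy
    exact mem_conjugatesOf_iff.2 (isConj_iff.2 ⟨c, by simp⟩)

theorem IsNC1.finite_fcCenter (hG : IsNC1 G) : Finite (fcCenter G) :=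
  GroupNC.finite_fcCenter hG.finite_finite_conjClasses

theorem IsNC1.exists_extension (hG : IsNC1 G) :
    ∃ (F Γ₀ : Type u) (_ : Group F) (_ : Group Γ₀),
      Nonempty (GroupExtension F G Γ₀) ∧ Finite F ∧ IsICC Γ₀ := by
  have := hG.infinite
  have := hG.finite_fcCenter
  exact ⟨fcCenter G, G ⧸ fcCenter G, inferInstance, inferInstance,
    ⟨{ inl := (fcCenter G).subtype
       rightHom := QuotientGroup.mk' (fcCenter G)
       inl_injective := Subtype.val_injective
       range_inl_eq_ker_rightHom := by simp
       rightHom_surjective := QuotientGroup.mk'_surjective _ }⟩, this, isICC_quotient_fcCenter⟩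

/-- An element with finite conjugacy class lies in the finite FC-centre and so has finite order. -/
theorem IsNC1.isICC_of_torsionFree (hG : IsNC1 G) (htf : ∀ g : G, g ≠ 1 → ¬ IsOfFinOrder g) :
    IsICC G := by
  refine ⟨hG.infinite, fun g hg hfin => htf g hg ?_⟩
  have := hG.finite_fcCenter
  exact (fcCenter G).subtype.isOfFinOrder (isOfFinOrder_of_finite (⟨g, hfin⟩ : fcCenter G))

/-! ### Inner amenability -/

/-- A conjugation invariant mean on an icc group without mass at `1` has no atoms. -/
theorem isNull_singleton_of_isICC (hG : IsICC G) {m : lp (fun _ : G => ℝ) ∞ →ₗ[ℝ] ℝ} (hm : IsMean m)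
    (hinv : ∀ g, InvariantUnder m (fun x => g * x * g⁻¹)) (h1 : IsNull m {1}) (x : G) :
    IsNull m {x} := by
  rcases eq_or_ne x 1 with rfl | hx
  · exact h1
  have hinf := hG.2 x hx
  have hconj : ∀ n, ∃ c : G, c * x * c⁻¹ = hinf.natEmbedding _ n := fun n =>
    isConj_iff.1 (mem_conjugatesOf_iff.1 (hinf.natEmbedding _ n).2)
  choose c hc using hconj
  -- The preimages of `{x}` under conjugation are singletons at distinct conjugates of `x`, all of
  -- the same mass.
  have hpre : ∀ n, (fun y => (c n)⁻¹ * y * (c n)⁻¹⁻¹) ⁻¹' {x}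
      = {((hinf.natEmbedding _ n : conjugatesOf x) : G)} := by
    intro n
    ext y
    rw [← hc n]
    simp only [Set.mem_preimage, Set.mem_singleton_iff, inv_inv]
    constructor
    · rintro rfl; group
    · rintro rfl; group
  refine isNull_of_almost_disjoint hm
    (fun n => (fun y => (c n)⁻¹ * y * (c n)⁻¹⁻¹) ⁻¹' {x})
    (fun n => mean_comp (hinv (c n)⁻¹) (IsBdd.indicator {x})) fun i j hij => ?_
  have hempty : (fun y => (c i)⁻¹ * y * (c i)⁻¹⁻¹) ⁻¹' {x}
      ∩ (fun y => (c j)⁻¹ * y * (c j)⁻¹⁻¹) ⁻¹' {x} = ∅ := by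
    rw [hpre, hpre, Set.singleton_inter_eq_empty, Set.mem_singleton_iff]
    exact fun h => hij.ne ((hinf.natEmbedding _).injective (Subtype.ext h))
  rw [hempty, IsNull, Set.indicator_empty]
  exact mean_const hm 0

theorem IsNC1.not_isInnerAmenable (hG : IsNC1 G) (hicc : IsICC G) : ¬ IsInnerAmenable G := by
  classical
  rintro ⟨m, hm, hinv, h1⟩
  refine hG.1 (isAmenable_of_top (hG.isAmenable_of_mean ⊤ hm (fun s _ => hinv s)
    (isNull_singleton_of_isICC hicc hm hinv ?_)))
  rw [IsNull, ← h1]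
  congr 1
  ext x
  rw [toLinf_apply (.indicator _), lp.single_apply]
  by_cases hx : x = 1
  · subst hx; simp
  · simp [hx]

end Orbits

end GroupNC

theorem theoremB (Γ : Type u) [Group Γ] [Countable Γ] (hΓ : GroupNC.IsNC1 Γ) :
    -- for every non-amenable normal subgroup `S`, there are only finitely many finite `S`-orbits
    (∀ S : Subgroup Γ, S.Normal → ¬ GroupNC.IsAmenable S →
      {O : Set Γ | O.Finite ∧ ∃ g : Γ, O = GroupNC.conjOrbit S g}.Finite) ∧
    -- there are only finitely many finite conjugacy classes
    {C : ConjClasses Γ | C.carrier.Finite}.Finite ∧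
    -- `Γ` is finite-by-icc
    (∃ (F Γ₀ : Type u) (_ : Group F) (_ : Group Γ₀),
      Nonempty (GroupExtension F Γ Γ₀) ∧ Finite F ∧ GroupNC.IsICC Γ₀) ∧
    -- the torsion free case
    ((∀ g : Γ, g ≠ 1 → ¬ IsOfFinOrder g) →
      GroupNC.IsICC Γ ∧ ¬ GroupNC.IsInnerAmenable Γ) :=
  ⟨fun S _ hS => hΓ.finite_finite_orbits S hS, hΓ.finite_finite_conjClasses, hΓ.exists_extension,
    fun htf => ⟨hΓ.isICC_of_torsionFree htf, hΓ.not_isInnerAmenable (hΓ.isICC_of_torsionFree htf)⟩⟩
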